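/- Let $m\ge 2$, let $p,q$ be odd primes with $q-p=2^m$, and let $D=D_1\cdots D_n$ be a product of distinct primes $D_1,\dots,D_n$ with $2\nmid D$, $p\nmid D$, $q\nmid D$. Put $\widehat{D_i}=D/D_i$ (an empty product is $1$). Let $$E=E_-:\ y^2=x(x-pD)(x-qD),\qquad E'=E'_-:\ y^2=x^3+2(p+q)Dx^2+4^mD^2x,$$ and let $\widehat\varphi:E'\to E$, $(x,y)\mapsto\bigl(y^2/4x^2,\ y(4^mD^2-x^2)/8x^2\bigr)$, be the isogeny of degree $2$ with kernel $E'[\widehat\varphi]=\{O,(0,0)\}$. Let $$S^{(\widehat\varphi)}(E'/\mathbb Q)=\ker\Bigl(H^1(\mathbb Q,E'[\widehat\varphi])\to\prod_v H^1(\mathbb Q_v,E')\Bigr)$$ ($v$ runs over all places of $\mathbb Q$) be its Selmer group, regarded as a subgroup of $\mathbb Q^{*}/\mathbb Q^{*2}\cong H^1(\mathbb Q,E'[\widehat\varphi])$. **Theorem A.4.** For $1\le i\le n$ let $$\Pi_i^-(D')=\Bigl(1-\Bigl(\tfrac{q\widehat{D_i}}{D_i}\Bigr)\Bigr)\Bigl(1-\Bigl(\tfrac{p\widehat{D_i}}{D_i}\Bigr)\Bigr)+\sum_{j\ne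 i}\Bigl(1-\Bigl(\tfrac{D_i}{D_j}\Bigr)\Bigr)\Bigl(1-\Bigl(\tfrac{pqD_i}{D_j}\Bigr)\Bigr),$$ where $\bigl(\tfrac{\cdot}{\cdot}\bigr)$ is the Legendre symbol. Let $I\subset\{1,\dots,n\}$ be the set of all $i$ satisfying at least one of the following conditions: * if $m=2$: $D_i\equiv1\pmod 4$; or $D_i-pD\equiv0\pmod 4$; or $D_i\equiv3\pmod 4$ and $p+D\equiv6\pmod 8$; * if $m=3$: $D_i\equiv1\pmod 8$; or $D_i-pD\equiv0\pmod 8$; or $D_i\equiv3\pmod 4$ and $pD-D_i\equiv4\pmod 8$; or $D_i\equiv5\pmod 8$ and $pD+D_i\equiv0\pmod 4$; * if $m=4$: $D_i\equiv1\pmod 8$; or $D_i-pD\equiv0\pmod 8$; or $D_i\equiv5\pmod 8$ and $pD-D_i\equiv4\pmod 8$; * if $m\ge5$: $D_i\equiv1\pmod 8$; or $D_i-pD\equiv0\pmod 8$. Put $\rho^-(D')=\sum_{i\in I}\left\lfloor\frac{1}{1+\Pi_i^-(D')}\right\rfloor$. Then there exists a subset $T\subset\{D_1,\dots,D_n\}$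 with exactly $\rho^-(D')$ elements such that the subgroup $\langle T\bmod\mathbb Q^{*2}\rangle$ of $\mathbb Q^{*}/\mathbb Q^{*2}$ generated by $T$ satisfies $$S^{(\widehat\varphi)}(E'/\mathbb Q)\supset\langle T\bmod\mathbb Q^{*2}\rangle\cong(\mathbb Z/2\mathbb Z)^{\rho^-(D')}.$$ In particular $\dim_2 S^{(\widehat\varphi)}(E'/\mathbb Q)\ge\rho^-(D')$. -/

import Mathlib

open scoped WeierstrassCurve.Affine

noncomputable section

/-- The Weierstrass cubic `y² = x³ + a x² + b x` over a field `K`. -/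
def quadCurve {K : Type} [Field K] (a b : K) : WeierstrassCurve.Affine K :=
  { a₁ := 0, a₂ := a, a₃ := 0, a₄ := b, a₆ := 0 }

/-- The points of `y² = x³ + a x² + b x` over the algebraic closure of `K`, including the point
at infinity. -/
abbrev GeomPoint {K : Type} [Field K] (a b : K) : Type :=
  ((quadCurve a b)⁄(AlgebraicClosure K)).Point

/-- The group law on the geometric points (Mathlib's, which asks for decidable equality). -/
instance geomPointGroup {K : Type} [Field K] (a b : K) : AddCommGroup (GeomPoint a b) :=
  letI : DecidableEq (AlgebraicClosure K) := Classical.decEq _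
  inferInstanceAs (AddCommGroup ((quadCurve a b)⁄(AlgebraicClosure K)).Point)

/-- The action of an automorphism `σ` of the algebraic closure of `K` over `K` on the geometric
points, `(x, y) ↦ (σ x, σ y)`. -/
def galAct {K : Type} [Field K] (a b : K)
    (σ : AlgebraicClosure K ≃ₐ[K] AlgebraicClosure K) : GeomPoint a b →+ GeomPoint a b :=
  letI : DecidableEq (AlgebraicClosure K) := Classical.decEq _
  WeierstrassCurve.Affine.Point.map (W' := quadCurve a b)
    (σ : AlgebraicClosure K →ₐ[K] AlgebraicClosure K)

theorem nonsingular_origin {K : Type} [Field K] (a b : K) (hb : b ≠ 0) :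
    ((quadCurve a b)⁄(AlgebraicClosure K)).Nonsingular 0 0 := by
  rw [WeierstrassCurve.Affine.nonsingular_zero]
  simp [quadCurve, WeierstrassCurve.baseChange, hb]

/-- The point `(0, 0)`. -/
def originPoint {K : Type} [Field K] (a b : K) (hb : b ≠ 0) : GeomPoint a b :=
  .some 0 0 (nonsingular_origin a b hb)

theorem originPoint_add_self {K : Type} [Field K] (a b : K) (hb : b ≠ 0) :
    originPoint a b hb + originPoint a b hb = 0 := by
  let _ : DecidableEq (AlgebraicClosure K) := Classical.decEq _
  refine WeierstrassCurve.Affine.Point.add_of_Y_eq rfl ?_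
  simp [quadCurve, WeierstrassCurve.baseChange, WeierstrassCurve.Affine.negY]

open scoped Classical in
/-- The Kummer cocycle of (the square of) `r`, with values in the subgroup `{O, (0, 0)}`:
`σ ↦ O` if `σ r = r`, and `σ ↦ (0, 0)` otherwise (that is, if `σ r = - r`). -/
def kummerCocycle {K : Type} [Field K] (a b : K) (hb : b ≠ 0) (r : AlgebraicClosure K)
    (σ : AlgebraicClosure K ≃ₐ[K] AlgebraicClosure K) : GeomPoint a b :=
  if σ r = r then 0 else originPoint a b hb

theorem kummerCocycle_mul {K : Type} [Field K] (a b : K) (hb : b ≠ 0)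
    {d e : K} {r s : AlgebraicClosure K} (hr : r ^ 2 = algebraMap K _ d)
    (hs : s ^ 2 = algebraMap K _ e) (hr0 : r ≠ 0) (hs0 : s ≠ 0)
    (σ : AlgebraicClosure K ≃ₐ[K] AlgebraicClosure K) :
    kummerCocycle a b hb (r * s) σ = kummerCocycle a b hb r σ + kummerCocycle a b hb s σ := by
  have key : ∀ (c : K) (t : AlgebraicClosure K), t ^ 2 = algebraMap K _ c → σ t = t ∨ σ t = -t := by
    intro c t ht
    apply sq_eq_sq_iff_eq_or_eq_neg.mp
    rw [← map_pow, ht, AlgEquiv.commutes]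
  unfold kummerCocycle
  rw [map_mul]
  by_cases h1 : σ r = r <;> by_cases h2 : σ s = s
  · simp [h1, h2]
  · simp [h1, h2, hr0]
  · simp [h1, h2, hs0]
  · have h1' := (key d r hr).resolve_left h1
    have h2' := (key e s hs).resolve_left h2
    rw [if_neg h1, if_neg h2, if_pos (by rw [h1', h2', neg_mul_neg]), originPoint_add_self]

theorem kummerCocycle_inv {K : Type} [Field K] (a b : K) (hb : b ≠ 0) (r : AlgebraicClosure K)
    (σ : AlgebraicClosure K ≃ₐ[K] AlgebraicClosure K) :
    kummerCocycle a b hb r⁻¹ σ = kummerCocycle a b hb r σ := by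
  have h : σ r⁻¹ = r⁻¹ ↔ σ r = r := by rw [map_inv₀]; exact inv_inj
  by_cases hr : σ r = r
  · rw [kummerCocycle, kummerCocycle, if_pos hr, if_pos (h.mpr hr)]
  · rw [kummerCocycle, kummerCocycle, if_neg hr, if_neg (mt h.mp hr)]

/-- Write `C` for `y² = x³ + a x² + b x` and `{O, (0, 0)}` for the kernel of the `2`-isogeny on `C`.
The kernel of `K* → K*/K*² ≅ H¹(K, {O, (0, 0)}) → H¹(K, C)`: the `d` whose Kummer cocycle
becomes a coboundary `σ ↦ σ P - P` of a geometric point `P` of `C`. -/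
def localSubgroup {K : Type} [Field K] (a b : K) (hb : b ≠ 0) : Subgroup Kˣ where
  carrier := {d | ∃ (r : AlgebraicClosure K) (P : GeomPoint a b),
    r ^ 2 = algebraMap K (AlgebraicClosure K) d ∧
    ∀ σ : AlgebraicClosure K ≃ₐ[K] AlgebraicClosure K,
      galAct a b σ P - P = kummerCocycle a b hb r σ}
  one_mem' := ⟨1, 0, by simp, fun σ => by simp [kummerCocycle]⟩
  mul_mem' := by
    rintro d e ⟨r, P, hr, hP⟩ ⟨s, Q, hs, hQ⟩
    have hr0 : r ≠ 0 := by
      rintro rfl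
      exact d.ne_zero (by simpa using hr.symm)
    have hs0 : s ≠ 0 := by
      rintro rfl
      exact e.ne_zero (by simpa using hs.symm)
    refine ⟨r * s, P + Q, by simp [mul_pow, hr, hs], fun σ => ?_⟩
    rw [kummerCocycle_mul a b hb hr hs hr0 hs0, ← hP, ← hQ, map_add]
    abel
  inv_mem' := by
    rintro d ⟨r, P, hr, hP⟩
    refine ⟨r⁻¹, P, by simp [inv_pow, hr], fun σ => ?_⟩
    rw [kummerCocycle_inv, hP]

/-- The group `ℚ*/ℚ*²`. -/
abbrev RatSqClass : Type := ℚˣ ⧸ (powMonoidHom 2 : ℚˣ →* ℚˣ).range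

/-- The map `ℚ* → K*` for a field `K` of characteristic zero. -/
abbrev toLocal (K : Type) [Field K] [Algebra ℚ K] : ℚˣ →* Kˣ :=
  Units.map (algebraMap ℚ K : ℚ →* K)

/-- The condition at the place of `ℚ` with completion `K`, for a curve defined over `ℚ`. -/
def placeSubgroup (K : Type) [Field K] [Algebra ℚ K] (a b : ℚ) (hb : b ≠ 0) : Subgroup ℚˣ :=
  (localSubgroup (algebraMap ℚ K a) (algebraMap ℚ K b)
    ((map_ne_zero (algebraMap ℚ K)).mpr hb)).comap (toLocal K)

/-- The Selmer group over `ℚ` of the `2`-isogeny with kernel `{O, (0, 0)}` on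
`C : y² = x³ + a x² + b x`, that is
`ker (H¹(ℚ, {O, (0, 0)}) → ∏_v H¹(ℚ_v, C))` over all places `v` of `ℚ`,
as a subgroup of `ℚ*/ℚ*² ≅ H¹(ℚ, {O, (0, 0)})`. -/
def twoIsogenySelmer (a b : ℚ) (hb : b ≠ 0) : Subgroup RatSqClass :=
  (placeSubgroup ℝ a b hb ⊓
    ⨅ l : Nat.Primes, haveI : Fact (l : ℕ).Prime := ⟨l.2⟩; placeSubgroup ℚ_[(l : ℕ)] a b hb).map
      (QuotientGroup.mk' _)

theorem selmer_coeff_ne_zero (m D : ℕ) (hD : D ≠ 0) : (4 ^ m * D ^ 2 : ℚ) ≠ 0 := by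
  positivity

/-- The Selmer group `S^(φ̂)(E'_ε/ℚ)`, where `E'_ε : y² = x³ - 2 ε (p + q) D x² + 4^m D² x` and
`φ̂ : E'_ε → E_ε`, `(x, y) ↦ (y² / 4x², y (4^m D² - x²) / 8x²)`, which has kernel `{O, (0, 0)}`,
is the isogeny of degree `2` onto `E_ε : y² = x (x + ε p D) (x + ε q D)`, `q - p = 2^m`. -/
def selmerDual (ε : ℤ) (p q m D : ℕ) (hD : D ≠ 0) : Subgroup RatSqClass :=
  twoIsogenySelmer (-2 * ε * (p + q) * D) (4 ^ m * D ^ 2) (selmer_coeff_ne_zero m D hD)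

/-- Every subgroup of `ℚ*/ℚ*²` is killed by `2`, so it is a vector space over `𝔽₂`. -/
instance sqClassModule (S : Subgroup RatSqClass) : Module (ZMod 2) (Additive S) :=
  AddCommGroup.zmodModule (n := 2) (by
    intro x
    obtain ⟨⟨y, hy⟩, rfl⟩ := Additive.ofMul.surjective x
    rw [← ofMul_pow, ← ofMul_one]
    congr 1
    apply Subtype.ext
    induction y using QuotientGroup.induction_on with
    | H u => exact (QuotientGroup.eq_one_iff (u ^ 2)).mpr ⟨u, rfl⟩)

/-- `dim₂ S`, the dimension over `𝔽₂`, as a cardinal. -/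
def dimTwo (S : Subgroup RatSqClass) : Cardinal := Module.rank (ZMod 2) (Additive S)

/-- `D = D_1 ⋯ D_n`. -/
def totalD {n : ℕ} (D : Fin n → ℕ) : ℕ := ∏ i, D i

/-- `D / D_i`, the product of the `D_j` with `j ≠ i` (an empty product is `1`). -/
def hatD {n : ℕ} (D : Fin n → ℕ) (i : Fin n) : ℕ := ∏ j ∈ Finset.univ.erase i, D j

theorem totalD_ne_zero {n : ℕ} (D : Fin n → ℕ) [hD : ∀ i, Fact (D i).Prime] : totalD D ≠ 0 :=
  Finset.prod_ne_zero_iff.mpr fun i _ => (hD i).out.ne_zero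

/-- `Π_i^-(D')`. -/
def PiMinus (p q : ℕ) {n : ℕ} (D : Fin n → ℕ) [∀ i, Fact (D i).Prime] (i : Fin n) : ℤ :=
  (1 - legendreSym (D i) (q * hatD D i)) * (1 - legendreSym (D i) (p * hatD D i)) +
    ∑ j ∈ Finset.univ.erase i,
      (1 - legendreSym (D j) (D i)) * (1 - legendreSym (D j) (p * q * D i))

/-- The condition `i ∈ I` (used for `m ≥ 2` only), where `P` stands for `p`, `N` for `D` and `d`
for `D_i`. -/
def InIndexSet (m : ℕ) (P N d : ℤ) : Prop :=
  (m = 2 ∧ (d ≡ 1 [ZMOD 4] ∨ d - P * N ≡ 0 [ZMOD 4] ∨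
      (d ≡ 3 [ZMOD 4] ∧ P + N ≡ 6 [ZMOD 8]))) ∨
  (m = 3 ∧ (d ≡ 1 [ZMOD 8] ∨ d - P * N ≡ 0 [ZMOD 8] ∨
      (d ≡ 3 [ZMOD 4] ∧ P * N - d ≡ 4 [ZMOD 8]) ∨
      (d ≡ 5 [ZMOD 8] ∧ P * N + d ≡ 0 [ZMOD 4]))) ∨
  (m = 4 ∧ (d ≡ 1 [ZMOD 8] ∨ d - P * N ≡ 0 [ZMOD 8] ∨
      (d ≡ 5 [ZMOD 8] ∧ P * N - d ≡ 4 [ZMOD 8]))) ∨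
  (5 ≤ m ∧ (d ≡ 1 [ZMOD 8] ∨ d - P * N ≡ 0 [ZMOD 8]))

open scoped Classical in
/-- The index set `I`. -/
def indexSet (m p : ℕ) {n : ℕ} (D : Fin n → ℕ) : Finset (Fin n) :=
  Finset.univ.filter fun i => InIndexSet m p (totalD D) (D i)

/-- `ρ^-(D') = ∑_{i ∈ I} ⌊1 / (1 + Π_i^-(D'))⌋`; the `Π_i^-(D')` are nonnegative, so that the floor
may be taken in `ℕ`. -/
def rhoMinus (m p q : ℕ) {n : ℕ} (D : Fin n → ℕ) [∀ i, Fact (D i).Prime] : ℕ :=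
  ∑ i ∈ indexSet m p D, ⌊(1 : ℚ) / (1 + PiMinus p q D i)⌋₊

end

noncomputable section

/-! The class of `d` dies in `H¹(K, E')` as soon as `d` is, modulo squares, the abscissa of a
`K`-point of `E`. Writing that abscissa as `d z²` with `d = D_i` and `H = D / D_i` turns this into a
`K`-point on the torsor `w² = d (z² - pH) (z² - qH)`. So each `D_i` with `i ∈ I` and `Π_i = 0` lies
in the Selmer group once its torsor is solvable at every place.

Over `ℝ` the point at infinity works, as `d > 0`. At an odd prime a point modulo `l` is lifted by
Hensel's lemma. Away from `2pqD` one exists because `(z² - A) (z² - B)` takes a zero or a nonsquare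
value (`of_good_reduction`); at `p` and `q` the cubic factor degenerates and `z² - c` plays this
role (`of_left_eq_zero`). At the primes dividing `D`, each vanishing term of `Π_i` makes one of two
numbers a square, and either gives a point. At `2` membership in `I` supplies a point
(`two_of_inIndexSet`).

Since `Π_i` is a nonnegative integer, the floor is `1` exactly when `Π_i = 0`, so `ρ` counts these
indices. The primes obtained are independent modulo squares by their valuations. -/

/-! ### Local triviality of a Kummer class from a point of a torsor. -/

theorem mem_localSubgroup_of_isSquare {K : Type} [Field K] (a b : K) (hb : b ≠ 0) (d : Kˣ)
    (hd : IsSquare (d : K)) : d ∈ localSubgroup a b hb := by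
  obtain ⟨s, hs⟩ := hd
  refine ⟨algebraMap K _ s, 0, by rw [hs, ← map_pow, sq], fun σ => ?_⟩
  simp [kummerCocycle]

/-- A `K`-point `(d z², Y)` of `y² = x (x - α) (x - β)` trivializes the Kummer class of `d`
on the isogenous curve. -/
theorem mem_localSubgroup_of_point {K : Type} [Field K] (h2 : (2 : K) ≠ 0) (a b : K) (hb : b ≠ 0)
    (α β : K) (ha : a = 2 * (α + β)) (hb' : b = (β - α) ^ 2) (d : Kˣ) (z Y : K) (hz : z ≠ 0)
    (hY : Y ^ 2 = d * z ^ 2 * (d * z ^ 2 - α) * (d * z ^ 2 - β)) :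
    d ∈ localSubgroup a b hb := by
  let _ : DecidableEq (AlgebraicClosure K) := Classical.decEq _
  obtain ⟨r, hr⟩ := IsAlgClosed.exists_pow_nat_eq (algebraMap K (AlgebraicClosure K) d)
    (n := 2) (by norm_num)
  set ι := algebraMap K (AlgebraicClosure K) with hι
  have hd0 : ι d ≠ 0 := (map_ne_zero ι).mpr d.ne_zero
  have hr0 : r ≠ 0 := by
    rintro rfl
    exact hd0 (by simpa using hr.symm)
  have hz0 : ι z ≠ 0 := (map_ne_zero ι).mpr hz
  have hb0 : ι b ≠ 0 := (map_ne_zero ι).mpr hb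
  have hι2 : ι 2 = 2 := map_ofNat ι 2
  have h20 : (2 : AlgebraicClosure K) ≠ 0 := hι2 ▸ (map_ne_zero ι).mpr h2
  have hY' : (ι Y) ^ 2 = r ^ 2 * ι z ^ 2 * (r ^ 2 * ι z ^ 2 - ι α) * (r ^ 2 * ι z ^ 2 - ι β) := by
    rw [hr]
    simpa using congrArg ι hY
  have ha' : ι a = 2 * (ι α + ι β) := by simp [ha, hι2]
  have hbb : ι b = (ι β - ι α) ^ 2 := by simp [hb']
  -- the two conjugate abscissae
  obtain ⟨x, hx⟩ : ∃ x, x = 2 * ι d * ι z ^ 2 - (ι α + ι β) - 2 * ι Y / (r * ι z) := ⟨_, rfl⟩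
  obtain ⟨x', hx'⟩ : ∃ x, x = 2 * ι d * ι z ^ 2 - (ι α + ι β) + 2 * ι Y / (r * ι z) := ⟨_, rfl⟩
  have hxx : x * x' = ι b := by
    have : (2 * ι Y / (r * ι z)) ^ 2
        = 4 * (r ^ 2 * ι z ^ 2 - ι α) * (r ^ 2 * ι z ^ 2 - ι β) := by
      rw [div_pow, mul_pow, hY']
      field_simp
      ring
    rw [hx, hx', hbb, ← hr]
    linear_combination -this
  have hxs : x + x' = 4 * r ^ 2 * ι z ^ 2 - ι a := by
    rw [hx, hx', ha', hr]
    ring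
  have hx0 : x ≠ 0 := fun h => hb0 (by rw [← hxx, h, zero_mul])
  have hy0 : 2 * x * r * ι z ≠ 0 :=
    mul_ne_zero (mul_ne_zero (mul_ne_zero h20 hx0) hr0) hz0
  -- The point lies above `(d z², Y)` under the isogeny: `y² / 4x² = d z²` suggests `y = 2 x r z`,
  -- and the curve equation then becomes the quadratic with roots `x`, `x'`.
  have hns : ((quadCurve a b)⁄(AlgebraicClosure K)).Nonsingular x (2 * x * r * ι z) := by
    rw [WeierstrassCurve.Affine.nonsingular_iff, WeierstrassCurve.Affine.equation_iff]
    refine ⟨?_, Or.inr ?_⟩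
    · simp only [quadCurve, WeierstrassCurve.baseChange, WeierstrassCurve.map, map_zero]
      linear_combination -x * (x * hxs - hxx)
    · simp only [quadCurve, WeierstrassCurve.baseChange, WeierstrassCurve.map, map_zero]
      intro h
      have : 2 * (2 * x * r * ι z) = 0 := by linear_combination h
      exact (mul_ne_zero h20 hy0) this
  refine ⟨r, .some _ _ hns, hr, fun σ => ?_⟩
  have hσ : σ r = r ∨ σ r = -r := by
    apply sq_eq_sq_iff_eq_or_eq_neg.mp
    rw [← map_pow, hr, AlgEquiv.commutes]
  have hσι : ∀ t, σ (ι t) = ι t := fun t => σ.commutes t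
  have hσ2 : σ 2 = 2 := map_ofNat σ 2
  have hact : ∀ (x₁ y₁ : AlgebraicClosure K)
      (h : ((quadCurve a b)⁄(AlgebraicClosure K)).Nonsingular x₁ y₁),
      ∃ h', galAct a b σ (.some x₁ y₁ h) = .some (σ x₁) (σ y₁) h' := fun x₁ y₁ h => ⟨_, rfl⟩
  obtain ⟨h', he⟩ := hact _ _ hns
  rw [he, kummerCocycle]
  rcases hσ with hσ | hσ
  · rw [if_pos hσ, sub_eq_zero]
    have h1 : σ x = x := by simp [hx, hσ, hσι, hσ2]
    have h2 : σ (2 * x * r * ι z) = 2 * x * r * ι z := by simp [h1, hσ, hσι, hσ2]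
    congr 1
  · have hne : ¬ σ r = r := by
      rw [hσ]
      intro h
      have : 2 * r = 0 := by linear_combination -h
      exact mul_ne_zero h20 hr0 this
    rw [if_neg hne, sub_eq_iff_eq_add]
    -- Replacing `r` by `-r` swaps the two roots; as `x x' = b`, this is translation by `(0, 0)`.
    have h1 : σ x = x' := by simp [hx, hx', hσ, hσι, hσ2, div_neg]
    have h2 : σ (2 * x * r * ι z) = -(2 * x' * r * ι z) := by simp [h1, hσ, hσι, hσ2]
    have hadd := WeierstrassCurve.Affine.Point.add_some
      (W := (quadCurve a b)⁄(AlgebraicClosure K)) (x₁ := 0) (y₁ := 0) (x₂ := x)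
      (y₂ := 2 * x * r * ι z) (h₁ := nonsingular_origin a b hb) (h₂ := hns)
      (fun h => hx0 h.1.symm)
    refine Eq.trans ?_ hadd.symm
    have hsl : ((quadCurve a b)⁄(AlgebraicClosure K)).slope 0 x 0 (2 * x * r * ι z)
        = 2 * r * ι z := by
      rw [WeierstrassCurve.Affine.slope_of_X_ne (Ne.symm hx0)]
      field_simp
      ring
    have hX : ((quadCurve a b)⁄(AlgebraicClosure K)).addX 0 x (2 * r * ι z) = x' := by
      simp only [WeierstrassCurve.Affine.addX, quadCurve, WeierstrassCurve.baseChange,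
        WeierstrassCurve.map, map_zero]
      linear_combination -hxs
    have hYY : ((quadCurve a b)⁄(AlgebraicClosure K)).addY 0 x 0 (2 * r * ι z)
        = -(2 * x' * r * ι z) := by
      rw [WeierstrassCurve.Affine.addY, WeierstrassCurve.Affine.negAddY, hX]
      simp only [WeierstrassCurve.Affine.negY, quadCurve, WeierstrassCurve.baseChange,
        WeierstrassCurve.map, map_zero]
      ring
    congr 1
    · rw [h1, hsl, hX]
    · rw [h2, hsl, hYY]

/-- The torsor `w² = d (z² - A) (z² - B)` has a `K`-point with `z ≠ 0`, possibly at infinity. -/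
def TorsorSolvable (K : Type) [Field K] (d A B : ℤ) : Prop :=
  IsSquare (d : K) ∨ ∃ z : K, z ≠ 0 ∧ IsSquare ((d : K) * ((z ^ 2 - A) * (z ^ 2 - B)))

theorem TorsorSolvable.symm {K : Type} [Field K] {d A B : ℤ} (h : TorsorSolvable K d A B) :
    TorsorSolvable K d B A :=
  h.imp id fun ⟨z, hz, hs⟩ => ⟨z, hz, by rwa [mul_comm ((z : K) ^ 2 - B)]⟩

theorem TorsorSolvable.of_isSquare_left {K : Type} [Field K] {d A : ℤ} (B : ℤ)
    (hA : (A : K) ≠ 0) (h : IsSquare (A : K)) : TorsorSolvable K d A B := by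
  obtain ⟨z, hz⟩ := h
  exact Or.inr ⟨z, by rintro rfl; exact hA (by simpa using hz), by simp [sq, hz]⟩

theorem TorsorSolvable.mem_placeSubgroup {K : Type} [Field K] [Algebra ℚ K] {d A B : ℤ}
    (h : TorsorSolvable K d A B) (a b : ℚ) (hb : b ≠ 0) (ha : a = 2 * (d * A + d * B))
    (hb' : b = (d * B - d * A) ^ 2) (u : ℚˣ) (hu : (u : ℚ) = d) : u ∈ placeSubgroup K a b hb := by
  have : CharZero K := algebraRat.charZero K
  have hu' : ((toLocal K u : Kˣ) : K) = d := by simp [toLocal, hu]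
  rw [placeSubgroup, Subgroup.mem_comap]
  rcases h with h | ⟨z, hz, w, hw⟩
  · exact mem_localSubgroup_of_isSquare _ _ _ _ (by rwa [hu'])
  · refine mem_localSubgroup_of_point two_ne_zero _ _ _ (d * A : K) (d * B : K) (by simp [ha])
      (by simp [hb']) _ (z : K) (d * z * w : K) hz ?_
    rw [hu']
    linear_combination -(d : K) ^ 2 * z ^ 2 * hw

/-! ### Square values over finite fields. -/

/-- An elementary replacement for point counting. Were all values nonzero squares, `A` would be a
nonsquare and `v = (z² - B) / (z² - A)` always a square. The inverse Möbius map `v ↦ (A v - B) / (v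
- 1)` would then send nonsquares to nonsquares, injectively and hence surjectively; but it takes the
value `A` only at infinity. -/
theorem exists_sq_sub_mul_sq_sub_eq_zero_or_not_isSquare {F : Type*} [Field F] [Finite F]
    {A B : F} (hAB : A ≠ B) :
    ∃ z : F, (z ^ 2 - A) * (z ^ 2 - B) = 0 ∨ ¬ IsSquare ((z ^ 2 - A) * (z ^ 2 - B)) := by
  by_contra! h
  have hA : ¬ IsSquare A := by
    rintro ⟨z, hz⟩
    exact (h z).1 (by simp [hz, sq])
  have hv : ∀ v : F, ¬ IsSquare v → v - 1 ≠ 0 := by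
    intro v hv h1
    exact hv (by rw [sub_eq_zero.mp h1]; exact IsSquare.one)
  let g : {v : F // ¬ IsSquare v} → {v : F // ¬ IsSquare v} := fun v =>
    ⟨(A * v - B) / (v - 1), by
      rintro ⟨z, hz⟩
      obtain ⟨w, hw⟩ := (h z).2
      have h1 := hv v v.2
      have hAB' : A - B ≠ 0 := sub_ne_zero.mpr hAB
      rw [sq, ← hz] at hw
      refine v.2 ⟨w * ((v - 1) / (A - B)), ?_⟩
      have : w * ((v - 1) / (A - B)) * (w * ((v - 1) / (A - B)))
          = (w * w) * ((v - 1) / (A - B)) ^ 2 := by ring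
      rw [this, ← hw]
      field_simp
      ring⟩
  have hg : Function.Injective g := by
    intro v w hvw
    have h1 := hv v v.2
    have h2 := hv w w.2
    have h3 : (A * v - B) / (v - 1) = (A * w - B) / ((w : F) - 1) := congrArg Subtype.val hvw
    rw [div_eq_div_iff h1 h2] at h3
    have h4 : (A - B) * ((w : F) - v) = 0 := by linear_combination h3
    rcases mul_eq_zero.mp h4 with h5 | h5
    · exact absurd (sub_eq_zero.mp h5) hAB
    · exact Subtype.ext (sub_eq_zero.mp h5).symm
  obtain ⟨v, hvA⟩ := Finite.surjective_of_injective hg ⟨A, hA⟩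
  have h1 := hv v v.2
  have h3 : (A * v - B) / (v - 1) = A := congrArg Subtype.val hvA
  rw [div_eq_iff h1] at h3
  exact hAB (by linear_combination h3)

/-- Otherwise the nonzero squares are stable under subtracting `c`. Starting from `1`, after `c⁻¹`
steps one reaches `0`. -/
theorem exists_ne_zero_sq_sub_eq_zero_or_not_isSquare {l : ℕ} [Fact l.Prime] {c : ZMod l}
    (hc : c ≠ 0) : ∃ z : ZMod l, z ≠ 0 ∧ (z ^ 2 - c = 0 ∨ ¬ IsSquare (z ^ 2 - c)) := by
  by_contra! h
  have key : ∀ k : ℕ, ∃ z : ZMod l, z ≠ 0 ∧ z ^ 2 = 1 - k * c := by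
    intro k
    induction k with
    | zero => exact ⟨1, one_ne_zero, by simp⟩
    | succ k ih =>
      obtain ⟨z, hz, hk⟩ := ih
      obtain ⟨h0, w, hw⟩ := h z hz
      refine ⟨w, ?_, ?_⟩
      · rintro rfl
        exact h0 (by simpa using hw)
      · push_cast
        linear_combination hk - hw
  obtain ⟨z, hz, hk⟩ := key (c⁻¹).val
  rw [ZMod.natCast_zmod_val, inv_mul_cancel₀ hc, sub_self] at hk
  exact hz (pow_eq_zero_iff two_ne_zero |>.mp hk)

theorem isSquare_mul_of_not_isSquare {l : ℕ} [Fact l.Prime] {x y : ZMod l}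
    (hx : ¬ IsSquare x) (hy : ¬ IsSquare y) : IsSquare (x * y) := by
  classical
  have hx0 : x ≠ 0 := by rintro rfl; exact hx IsSquare.zero
  have hy0 : y ≠ 0 := by rintro rfl; exact hy IsSquare.zero
  rw [← quadraticChar_one_iff_isSquare (mul_ne_zero hx0 hy0), map_mul,
    quadraticChar_neg_one_iff_not_isSquare.mpr hx, quadraticChar_neg_one_iff_not_isSquare.mpr hy]
  norm_num

/-! ### Squares in the `l`-adic numbers by Hensel's lemma. -/

theorem isSquare_padic_of_sq_sub {l : ℕ} [Fact l.Prime] (u t : ℤ)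
    (h : ‖((t ^ 2 - u : ℤ) : ℤ_[l])‖ < ‖((2 * t : ℤ) : ℤ_[l])‖ ^ 2) :
    IsSquare (u : ℚ_[l]) := by
  obtain ⟨z, hz, -⟩ := hensels_lemma (p := l) (R := ℤ_[l])
    (F := (Polynomial.X ^ 2 - Polynomial.C (u : ℤ_[l]))) (a := (t : ℤ_[l]))
    (by simpa [Polynomial.derivative_X_pow, one_add_one_eq_two] using h)
  refine ⟨(z : ℚ_[l]), ?_⟩
  have h1 : z ^ 2 = (u : ℤ_[l]) := by
    simpa [sub_eq_zero] using hz
  have := congrArg (fun s : ℤ_[l] => (s : ℚ_[l])) h1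
  simpa [sq] using this.symm

theorem isSquare_padic_of_isSquare_zmod {l : ℕ} [Fact l.Prime] (hl : l ≠ 2) (u : ℤ)
    (hu : (u : ZMod l) ≠ 0) (h : IsSquare (u : ZMod l)) : IsSquare (u : ℚ_[l]) := by
  obtain ⟨t, ht⟩ := h
  obtain ⟨t, rfl⟩ := ZMod.intCast_surjective t
  have h2 : (2 : ZMod l) ≠ 0 := by
    intro h
    have : ((2 : ℕ) : ZMod l) = 0 := by exact_mod_cast h
    rw [ZMod.natCast_eq_zero_iff] at this
    exact hl ((Nat.prime_dvd_prime_iff_eq Fact.out Nat.prime_two).mp this)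
  have ht0 : (t : ZMod l) ≠ 0 := by
    intro h
    exact hu (by simpa [h] using ht)
  refine isSquare_padic_of_sq_sub u t ?_
  have h1 : ‖((t ^ 2 - u : ℤ) : ℤ_[l])‖ < 1 := by
    rw [PadicInt.norm_intCast_lt_one_iff, ← ZMod.intCast_zmod_eq_zero_iff_dvd]
    push_cast
    rw [ht]
    ring
  have h3 : ‖((2 * t : ℤ) : ℤ_[l])‖ = 1 := by
    refine le_antisymm (PadicInt.norm_le_one _) (not_lt.mp fun h => ?_)
    rw [PadicInt.norm_intCast_lt_one_iff, ← ZMod.intCast_zmod_eq_zero_iff_dvd] at h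
    push_cast at h
    exact mul_ne_zero h2 ht0 h
  rw [h3]
  simpa using h1

theorem isSquare_padic_two (u : ℤ) (h : u ≡ 1 [ZMOD 8]) : IsSquare (u : ℚ_[2]) := by
  refine isSquare_padic_of_sq_sub u 1 ?_
  have h1 : ‖((1 ^ 2 - u : ℤ) : ℤ_[2])‖ ≤ (2 : ℝ) ^ (-3 : ℤ) := by
    have := (PadicInt.norm_int_le_pow_iff_dvd (p := 2) (k := 1 ^ 2 - u) (n := 3)).mpr
      (by simpa using h.dvd)
    simpa using this
  have h2 : ‖((2 * 1 : ℤ) : ℤ_[2])‖ = (2 : ℝ)⁻¹ := by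
    simpa using PadicInt.norm_p (p := 2)
  rw [h2]
  refine h1.trans_lt ?_
  norm_num

/-! ### Solvability of the torsor, by type of place. -/

namespace TorsorSolvable

variable {l : ℕ} [Fact l.Prime] {d A B : ℤ}

theorem of_isSquare_zmod_left (hl : l ≠ 2) (hA : (A : ZMod l) ≠ 0) (h : IsSquare (A : ZMod l)) :
    TorsorSolvable ℚ_[l] d A B :=
  of_isSquare_left B (by
    rw [Int.cast_ne_zero]
    rintro rfl
    simp at hA) (isSquare_padic_of_isSquare_zmod hl A hA h)

theorem of_point_zmod (hl : l ≠ 2) (z : ZMod l)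
    (h0 : (d : ZMod l) * ((z ^ 2 - A) * (z ^ 2 - B)) ≠ 0)
    (h : IsSquare ((d : ZMod l) * ((z ^ 2 - A) * (z ^ 2 - B)))) :
    TorsorSolvable ℚ_[l] d A B := by
  obtain ⟨t, ht0, rfl⟩ : ∃ t : ℤ, t ≠ 0 ∧ (t : ZMod l) = z := by
    obtain ⟨t, rfl⟩ := ZMod.intCast_surjective z
    by_cases ht : t = 0
    -- The torsor point must have `z ≠ 0`, so the residue `0` is lifted to `l`.
    · exact ⟨l, by exact_mod_cast (Fact.out : l.Prime).ne_zero, by simp [ht]⟩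
    · exact ⟨t, ht, rfl⟩
  refine Or.inr ⟨t, by exact_mod_cast ht0, ?_⟩
  have := isSquare_padic_of_isSquare_zmod hl (d * ((t ^ 2 - A) * (t ^ 2 - B)))
    (by push_cast; exact h0) (by push_cast; exact h)
  exact_mod_cast this

/-- For a nonsquare `d`, a nonsquare value of `(z² - A) (z² - B)` makes the product a nonzero
square, while a zero value makes `A` or `B` a square and gives a point with `w = 0`. -/
theorem of_good_reduction (hl : l ≠ 2) (hd : (d : ZMod l) ≠ 0) (hA : (A : ZMod l) ≠ 0)
    (hB : (B : ZMod l) ≠ 0) (hAB : (A : ZMod l) ≠ B) : TorsorSolvable ℚ_[l] d A B := by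
  by_cases hs : IsSquare (d : ZMod l)
  · exact Or.inl (isSquare_padic_of_isSquare_zmod hl d hd hs)
  obtain ⟨z, hz | hz⟩ := exists_sq_sub_mul_sq_sub_eq_zero_or_not_isSquare hAB
  · rcases mul_eq_zero.mp hz with h | h
    · exact of_isSquare_zmod_left hl hA ⟨z, by linear_combination -h⟩
    · exact (of_isSquare_zmod_left hl hB ⟨z, by linear_combination -h⟩).symm
  · refine of_point_zmod hl z (mul_ne_zero hd ?_) (isSquare_mul_of_not_isSquare hs hz)
    intro h
    rw [h] at hz
    exact hz IsSquare.zero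

theorem of_left_eq_zero (hl : l ≠ 2) (hd : (d : ZMod l) ≠ 0) (hA : (A : ZMod l) = 0)
    (hB : (B : ZMod l) ≠ 0) : TorsorSolvable ℚ_[l] d A B := by
  by_cases hs : IsSquare (d : ZMod l)
  · exact Or.inl (isSquare_padic_of_isSquare_zmod hl d hd hs)
  obtain ⟨z, hz0, hz | hz⟩ := exists_ne_zero_sq_sub_eq_zero_or_not_isSquare hB
  · exact (of_isSquare_zmod_left hl hB ⟨z, by linear_combination -hz⟩).symm
  · have h0 : z ^ 2 - (B : ZMod l) ≠ 0 := by
      intro h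
      rw [h] at hz
      exact hz IsSquare.zero
    refine of_point_zmod hl z ?_ ?_
    · rw [hA, sub_zero]
      exact mul_ne_zero hd (mul_ne_zero (pow_ne_zero 2 hz0) h0)
    · have : (d : ZMod l) * ((z ^ 2 - A) * (z ^ 2 - B)) = (d * (z ^ 2 - B)) * (z * z) := by
        rw [hA]
        ring
      rw [this]
      exact (isSquare_mul_of_not_isSquare hs hz).mul ⟨z, rfl⟩

/-- At a prime dividing both `A` and `B` exactly once. -/
theorem of_multiplicative (hl : l ≠ 2) (P Q N : ℤ) (hd : (d : ZMod l) ≠ 0)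
    (hP : (P : ZMod l) ≠ 0) (hQ : (Q : ZMod l) ≠ 0) (hN : (N : ZMod l) ≠ 0)
    (h : IsSquare (d : ZMod l) ∨ IsSquare ((P * Q * d : ℤ) : ZMod l)) :
    TorsorSolvable ℚ_[l] d (P * (l * N)) (Q * (l * N)) := by
  rcases h with h | ⟨t, ht⟩
  · exact Or.inl (isSquare_padic_of_isSquare_zmod hl d hd h)
  have hl0 : (l : ℚ_[l]) ≠ 0 := by exact_mod_cast (Fact.out : l.Prime).ne_zero
  -- At `z = l` the right-hand side is `l²` times a unit congruent to `P Q d N²`.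
  refine Or.inr ⟨l, hl0, ?_⟩
  have h1 : ((d * ((l - P * N) * (l - Q * N)) : ℤ) : ZMod l) = (P * Q * d) * N ^ 2 := by
    push_cast
    rw [CharP.cast_eq_zero]
    ring
  have h2 := isSquare_padic_of_isSquare_zmod hl (d * ((l - P * N) * (l - Q * N)))
    (by rw [h1]; exact mul_ne_zero (mul_ne_zero (mul_ne_zero hP hQ) hd) (pow_ne_zero 2 hN))
    ⟨t * N, by rw [h1]; push_cast at ht; rw [ht]; ring⟩
  have h3 : (d : ℚ_[l]) * (((l : ℚ_[l]) ^ 2 - ((P * (l * N) : ℤ) : ℚ_[l]))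
      * ((l : ℚ_[l]) ^ 2 - ((Q * (l * N) : ℤ) : ℚ_[l])))
      = ((d * ((l - P * N) * (l - Q * N)) : ℤ) : ℚ_[l]) * (l * l) := by
    push_cast
    ring
  rw [h3]
  exact h2.mul ⟨_, rfl⟩

theorem real {d : ℤ} (hd : 0 < d) (A B : ℤ) : TorsorSolvable ℝ d A B :=
  Or.inl (Real.isSquare_iff.mpr (by exact_mod_cast hd.le))

theorem two_of_left {d A B : ℤ} (h : A ≡ 1 [ZMOD 8]) : TorsorSolvable ℚ_[2] d A B :=
  of_isSquare_left B (by
    rw [Int.cast_ne_zero]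
    rintro rfl
    exact absurd h (by decide)) (isSquare_padic_two A h)

theorem two_of_point {d A B : ℤ} (z k u : ℤ) (hz : z ≠ 0)
    (h : d * ((z ^ 2 - A) * (z ^ 2 - B)) = k ^ 2 * u) (hu : (u : ZMod 8) = 1) :
    TorsorSolvable ℚ_[2] d A B := by
  refine Or.inr ⟨z, by exact_mod_cast hz, ?_⟩
  have h1 : (d : ℚ_[2]) * (((z : ℚ_[2]) ^ 2 - A) * ((z : ℚ_[2]) ^ 2 - B)) = k * k * u := by
    have := congrArg (fun t : ℤ => (t : ℚ_[2])) h
    push_cast at this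
    rw [this, sq]
  rw [h1]
  refine IsSquare.mul ⟨_, rfl⟩ (isSquare_padic_two u ?_)
  exact (ZMod.intCast_eq_intCast_iff u 1 8).mp (by simpa using hu)

/-- Each clause of `I` yields one of these points: infinity (`d` a `2`-adic square), `w = 0` (`P H`
or `(P + 2 ^ m) H` a square), or `z ∈ {1, 2, 3}`. -/
theorem two_of_inIndexSet {m : ℕ} {P N d H : ℤ} (hN : N = d * H) (hd : Odd d)
    (hP : Odd P) (hH : Odd H) (h : InIndexSet m P N d) :
    TorsorSolvable ℚ_[2] d (P * H) ((P + 2 ^ m) * H) := by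
  -- All hypotheses are moved to `ZMod 8` for `decide`: oddness becomes `4 t = 4`, and a congruence
  -- modulo `4` becomes `2 x = 2 y`.
  have four_mul : ∀ {t : ℤ}, Odd t → (4 * t : ZMod 8) = 4 := by
    rintro t ⟨s, rfl⟩
    have h8 : (8 : ZMod 8) = 0 := rfl
    push_cast
    linear_combination (s : ZMod 8) * h8
  have hd' := four_mul hd
  have hP' := four_mul hP
  have hH' := four_mul hH
  have hH2 : (H * H : ZMod 8) = 1 := by
    revert hH'
    generalize (H : ZMod 8) = x
    revert x
    decide
  have cast4 : ∀ {x y : ℤ}, x ≡ y [ZMOD 4] → (2 * x : ZMod 8) = 2 * y := by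
    intro x y hxy
    have := (ZMod.intCast_eq_intCast_iff (2 * x) (2 * y) 8).mpr
      (Int.ModEq.mul_left' (c := 2) hxy)
    exact_mod_cast this
  have cast8 : ∀ {x y : ℤ}, x ≡ y [ZMOD 8] → (x : ZMod 8) = y := fun {x y} hxy =>
    (ZMod.intCast_eq_intCast_iff x y 8).mpr hxy
  have left : (P * H : ZMod 8) = 1 → TorsorSolvable ℚ_[2] d (P * H) ((P + 2 ^ m) * H) := by
    intro h
    exact two_of_left ((ZMod.intCast_eq_intCast_iff (P * H) 1 8).mp (by exact_mod_cast h))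
  have right : ((P + 2 ^ m) * H : ZMod 8) = 1 →
      TorsorSolvable ℚ_[2] d (P * H) ((P + 2 ^ m) * H) := by
    intro h
    exact (two_of_left ((ZMod.intCast_eq_intCast_iff ((P + 2 ^ m) * H) 1 8).mp
      (by exact_mod_cast h))).symm
  have one_mod : d ≡ 1 [ZMOD 8] → TorsorSolvable ℚ_[2] d (P * H) ((P + 2 ^ m) * H) :=
    fun h => Or.inl (isSquare_padic_two d h)
  have zero_mod : d - P * N ≡ 0 [ZMOD 8] →
      TorsorSolvable ℚ_[2] d (P * H) ((P + 2 ^ m) * H) := by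
    intro h
    have h1 := cast8 h
    rw [hN] at h1
    push_cast at h1
    refine left ?_
    clear left right one_mod cast4 cast8 four_mul
    revert hd' hP' hH' h1
    generalize (H : ZMod 8) = x, (P : ZMod 8) = y, (d : ZMod 8) = w
    revert x y w
    decide
  -- `P H = 1 - 2 α`
  obtain ⟨α, hα⟩ : ∃ α, P * H = 1 - 2 * α := by
    obtain ⟨s, hs⟩ := hP.mul hH
    exact ⟨-s, by rw [hs]; ring⟩
  have hPα : (P : ZMod 8) = (1 - 2 * α) * H := by
    have : (P * H : ZMod 8) = 1 - 2 * α := by exact_mod_cast congrArg (Int.cast : ℤ → ZMod 8) hα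
    linear_combination (H : ZMod 8) * this - P * hH2
  have point : ∀ {z k u : ℤ}, z ≠ 0 →
      d * ((z ^ 2 - P * H) * (z ^ 2 - (P + 2 ^ m) * H)) = k ^ 2 * u →
      (u : ZMod 8) = 1 → TorsorSolvable ℚ_[2] d (P * H) ((P + 2 ^ m) * H) :=
    fun hz h hu => two_of_point _ _ _ hz h hu
  have even_of : P * N - d ≡ 4 [ZMOD 8] → ∃ a, α = a + a := by
    intro h
    obtain ⟨k, hk⟩ := h.dvd
    have h1 : Even (α * d) := ⟨2 * k - 1, by
      rw [hN] at hk
      linarith [show P * (d * H) = d * (1 - 2 * α) by rw [← hα]; ring,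
        show d * (1 - 2 * α) = d - 2 * (α * d) by ring]⟩
    exact (Int.even_mul.mp h1).resolve_right (Int.not_even_iff_odd.mpr hd)
  rcases h with ⟨rfl, h⟩ | ⟨rfl, h⟩ | ⟨rfl, h⟩ | ⟨h5, h⟩
  · rcases h with h | h | ⟨h, h'⟩
    · by_cases h1 : (d : ZMod 8) = 1
      · exact one_mod ((ZMod.intCast_eq_intCast_iff d 1 8).mp (by exact_mod_cast h1))
      -- Here `d ≡ 5` modulo `8`, and so is the product of the other two factors.
      · refine point (z := 2) (k := 1) (u := d * ((2 ^ 2 - P * H) * (2 ^ 2 - (P + 2 ^ 2) * H)))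
          two_ne_zero (by ring) ?_
        have h2 := cast4 h
        push_cast at h2 ⊢
        clear left right one_mod zero_mod point cast4 cast8 four_mul even_of hα hPα
        revert hP' hH' h1 h2
        generalize (H : ZMod 8) = x, (P : ZMod 8) = y, (d : ZMod 8) = w
        revert x y w
        decide
    · have h1 := cast4 h
      rw [hN] at h1
      push_cast at h1
      have h2 : (P * H : ZMod 8) = 1 ∨ ((P + 2 ^ 2) * H : ZMod 8) = 1 := by
        clear left right one_mod zero_mod point cast4 cast8 four_mul even_of hα hPα
        revert hP' hH' h1 hd'
        generalize (H : ZMod 8) = x, (P : ZMod 8) = y, (d : ZMod 8) = w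
        revert x y w
        decide
      exact h2.elim left right
    -- At `z = 1` the factors are `2 α` and `2 α - 2 ^ m H`, whence the square `4` drops out; when
    -- `α = 2 a` below, `16` does.
    · refine point (z := 1) (k := 2) (u := d * (α * (α - 2 * H))) one_ne_zero
        (by linear_combination d * (4 * H - 2 + P * H + (1 - 2 * α)) * hα) ?_
      have h1 := cast4 h
      have h2 := cast8 h'
      rw [hN] at h2
      push_cast at h1 h2 ⊢
      rw [hPα] at h2
      clear left right one_mod zero_mod point cast4 cast8 four_mul even_of hα hPα
      revert hH' h1 h2
      generalize (H : ZMod 8) = x, (α : ZMod 8) = y, (d : ZMod 8) = w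
      revert x y w
      decide
  · rcases h with h | h | ⟨h, h'⟩ | ⟨h, h'⟩
    · exact one_mod h
    · exact zero_mod h
    · obtain ⟨a, rfl⟩ := even_of h'
      have h1 := cast4 h
      have h2 := cast8 h'
      rw [hN] at h2
      push_cast at h1 h2 hPα
      rw [hPα] at h2
      -- Passing from `z = 1` to `z = 3` adds `8 = 4 · 2` to both factors, which replaces `a` by `a
      -- + 2`.
      have h3 : (d * (a * (a - 2 * H)) : ZMod 8) = 1 ∨
          (d * ((a + 2) * (a + 2 - 2 * H)) : ZMod 8) = 1 := by
        clear left right one_mod zero_mod point cast4 cast8 four_mul even_of hα hPα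
        revert hH' h1 h2
        generalize (H : ZMod 8) = x, (a : ZMod 8) = y, (d : ZMod 8) = w
        revert x y w
        decide
      rcases h3 with h3 | h3
      · exact point (z := 1) (k := 4) (u := d * (a * (a - 2 * H))) one_ne_zero
          (by linear_combination d * (8 * H - 2 + P * H + (1 - 2 * (a + a))) * hα)
          (by exact_mod_cast h3)
      · exact point (z := 3) (k := 4) (u := d * ((a + 2) * (a + 2 - 2 * H))) three_ne_zero
          (by linear_combination d * (8 * H - 18 + P * H + (1 - 2 * (a + a))) * hα)
          (by exact_mod_cast h3)
    · refine point (z := 1) (k := 2) (u := d * (α * (α - 4 * H))) one_ne_zero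
        (by linear_combination d * (8 * H - 2 + P * H + (1 - 2 * α)) * hα) ?_
      have h1 := cast8 h
      have h2 := cast4 h'
      rw [hN] at h2
      push_cast at h1 h2 ⊢
      rw [hPα] at h2
      clear left right one_mod zero_mod point cast4 cast8 four_mul even_of hα hPα
      revert hH' h1 h2
      generalize (H : ZMod 8) = x, (α : ZMod 8) = y, (d : ZMod 8) = w
      revert x y w
      decide
  · rcases h with h | h | ⟨h, h'⟩
    · exact one_mod h
    · exact zero_mod h
    · obtain ⟨a, rfl⟩ := even_of h'
      refine point (z := 1) (k := 4) (u := d * (a * (a - 4 * H))) one_ne_zero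
        (by linear_combination d * (16 * H - 2 + P * H + (1 - 2 * (a + a))) * hα) ?_
      have h1 := cast8 h
      have h2 := cast8 h'
      rw [hN] at h2
      push_cast at h1 h2 hPα ⊢
      rw [hPα] at h2
      clear left right one_mod zero_mod point cast4 cast8 four_mul even_of hα hPα
      revert hH' h1 h2
      generalize (H : ZMod 8) = x, (a : ZMod 8) = y, (d : ZMod 8) = w
      revert x y w
      decide
  · exact h.elim one_mod zero_mod
end TorsorSolvable

/-! ### Legendre symbols and the vanishing of `Π_i`. -/

theorem isSquare_of_legendreSym_eq_one {l : ℕ} [Fact l.Prime] {a : ℤ} (h : legendreSym l a = 1) :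
    IsSquare (a : ZMod l) := by
  by_cases ha : (a : ZMod l) = 0
  · rw [ha]
    exact IsSquare.zero
  · exact (legendreSym.eq_one_iff l ha).mp h

theorem legendreSym_le_one (l : ℕ) [Fact l.Prime] (a : ℤ) : legendreSym l a ≤ 1 := by
  by_cases ha : (a : ZMod l) = 0
  · rw [(legendreSym.eq_zero_iff l a).mpr ha]
    exact zero_le_one
  · rcases legendreSym.eq_one_or_neg_one l ha with h | h <;> simp [h]

theorem one_sub_legendreSym_mul_nonneg (l : ℕ) [Fact l.Prime] (a b : ℤ) :
    0 ≤ (1 - legendreSym l a) * (1 - legendreSym l b) :=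
  mul_nonneg (sub_nonneg.mpr (legendreSym_le_one l a)) (sub_nonneg.mpr (legendreSym_le_one l b))

theorem isSquare_or_isSquare_of_one_sub_legendreSym_mul_eq_zero {l : ℕ} [Fact l.Prime] {a b : ℤ}
    (h : (1 - legendreSym l a) * (1 - legendreSym l b) = 0) :
    IsSquare (a : ZMod l) ∨ IsSquare (b : ZMod l) :=
  (mul_eq_zero.mp h).imp (fun h => isSquare_of_legendreSym_eq_one (sub_eq_zero.mp h).symm)
    (fun h => isSquare_of_legendreSym_eq_one (sub_eq_zero.mp h).symm)

section PiMinus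

variable (p q : ℕ) {n : ℕ} (D : Fin n → ℕ) [∀ i, Fact (D i).Prime]

theorem PiMinus_nonneg (i : Fin n) : 0 ≤ PiMinus p q D i :=
  add_nonneg (one_sub_legendreSym_mul_nonneg _ _ _)
    (Finset.sum_nonneg fun _ _ => one_sub_legendreSym_mul_nonneg _ _ _)

theorem isSquare_or_isSquare_of_PiMinus_eq_zero {i : Fin n} (h : PiMinus p q D i = 0) :
    (IsSquare ((q * hatD D i : ℤ) : ZMod (D i)) ∨ IsSquare ((p * hatD D i : ℤ) : ZMod (D i))) ∧
    ∀ j, j ≠ i → IsSquare ((D i : ℤ) : ZMod (D j)) ∨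
      IsSquare ((p * q * D i : ℤ) : ZMod (D j)) := by
  have h1 := (add_eq_zero_iff_of_nonneg (one_sub_legendreSym_mul_nonneg _ _ _)
    (Finset.sum_nonneg fun _ _ => one_sub_legendreSym_mul_nonneg _ _ _)).mp h
  refine ⟨isSquare_or_isSquare_of_one_sub_legendreSym_mul_eq_zero h1.1, fun j hj => ?_⟩
  exact isSquare_or_isSquare_of_one_sub_legendreSym_mul_eq_zero
    ((Finset.sum_eq_zero_iff_of_nonneg fun _ _ => one_sub_legendreSym_mul_nonneg _ _ _).mp h1.2 j
      (Finset.mem_erase.mpr ⟨hj, Finset.mem_univ j⟩))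

/-- The indices `i ∈ I` that contribute to `ρ^-(D')`. -/
def solvableIndices (m : ℕ) : Finset (Fin n) :=
  (indexSet m p D).filter fun i => PiMinus p q D i = 0

/-- For an integer `Π_i ≥ 0` the floor is `1` if `Π_i = 0` and `0` otherwise. -/
theorem card_solvableIndices (m : ℕ) : (solvableIndices p q D m).card = rhoMinus m p q D := by
  rw [solvableIndices, Finset.card_filter, rhoMinus]
  refine Finset.sum_congr rfl fun i _ => ?_
  have h0 := PiMinus_nonneg p q D i
  split_ifs with h
  · simp [h]
  · have h1 : (1 : ℚ) ≤ PiMinus p q D i := by exact_mod_cast (by omega : 1 ≤ PiMinus p q D i)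
    symm
    rw [Nat.floor_eq_zero, div_lt_one (by linarith)]
    linarith

end PiMinus

/-! ### Solvability at every prime and membership in the Selmer group. -/

theorem totalD_eq_mul_hatD {n : ℕ} (D : Fin n → ℕ) (i : Fin n) : totalD D = D i * hatD D i :=
  (Finset.mul_prod_erase _ _ (Finset.mem_univ i)).symm

theorem hatD_eq_mul_prod {n : ℕ} (D : Fin n → ℕ) {i j : Fin n} (hj : j ≠ i) :
    hatD D i = D j * ∏ k ∈ (Finset.univ.erase i).erase j, D k :=
  (Finset.mul_prod_erase _ _ (Finset.mem_erase.mpr ⟨hj, Finset.mem_univ j⟩)).symm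

theorem Nat.Prime.not_dvd_prod_primes {ι : Type*} {D : ι → ℕ} [hD : ∀ i, Fact (D i).Prime] {l : ℕ}
    (hl : l.Prime) {s : Finset ι} (h : ∀ k ∈ s, D k ≠ l) : ¬ l ∣ ∏ k ∈ s, D k := by
  rw [hl.prime.dvd_finsetProd_iff]
  rintro ⟨k, hk, hlk⟩
  exact h k hk ((Nat.prime_dvd_prime_iff_eq hl (hD k).out).mp hlk).symm

theorem torsorSolvable_padic {m p q n : ℕ} (hp : p.Prime) (hq : q.Prime)
    (hp2 : p ≠ 2) (hpq : q = p + 2 ^ m) (hm : 2 ≤ m)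
    (D : Fin n → ℕ) [hD : ∀ i, Fact (D i).Prime] (hinj : Function.Injective D)
    (h2D : ¬ 2 ∣ totalD D) (hpD : ¬ p ∣ totalD D) (hqD : ¬ q ∣ totalD D)
    {i : Fin n} (hI : InIndexSet m p (totalD D) (D i)) (hPi : PiMinus p q D i = 0)
    (l : ℕ) [hl : Fact l.Prime] :
    TorsorSolvable ℚ_[l] (D i) (p * hatD D i) (q * hatD D i) := by
  have hN := totalD_eq_mul_hatD D i
  have hodd : Odd (D i * hatD D i) := by rwa [← hN, ← Nat.not_even_iff_odd, even_iff_two_dvd]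
  obtain ⟨hdo, hHo⟩ := Nat.odd_mul.mp hodd
  have hpo : Odd p := hp.odd_of_ne_two hp2
  have hqo : Odd q := by
    rw [hpq]
    exact hpo.add_even ((Nat.even_pow.mpr ⟨even_two, by omega⟩))
  by_cases hl2 : l = 2
  · subst hl2
    have := TorsorSolvable.two_of_inIndexSet (m := m) (P := p) (N := totalD D) (d := D i)
      (H := hatD D i) (by exact_mod_cast hN) (by exact_mod_cast hdo) (by exact_mod_cast hpo)
      (by exact_mod_cast hHo) hI
    rw [hpq]
    exact_mod_cast this
  have ne_zero : ∀ {t : ℕ}, ¬ l ∣ t → (((t : ℕ) : ℤ) : ZMod l) ≠ 0 := by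
    intro t ht h
    rw [Int.cast_natCast, ZMod.natCast_eq_zero_iff] at h
    exact ht h
  have ne_zero_mul : ∀ {t s : ℕ}, ¬ l ∣ t → ¬ l ∣ s → ((t * s : ℤ) : ZMod l) ≠ 0 := by
    intro t s ht hs
    exact_mod_cast ne_zero (t := t * s) (hl.out.not_dvd_mul ht hs)
  have prime_ne : ∀ {t : ℕ}, t.Prime → l ≠ t → ¬ l ∣ t := fun ht hlt h =>
    hlt ((Nat.prime_dvd_prime_iff_eq hl.out ht).mp h)
  have hl_two : ((2 : ℤ) : ZMod l) ≠ 0 := ne_zero (t := 2) (prime_ne Nat.prime_two hl2)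
  have hpq_ne : p ≠ q := by
    rw [hpq]
    have := Nat.two_pow_pos m
    omega
  obtain ⟨hi, hj⟩ := isSquare_or_isSquare_of_PiMinus_eq_zero p q D hPi
  by_cases hlN : l ∣ totalD D
  · have hlp : ¬ l ∣ p := prime_ne hp (by rintro rfl; exact hpD hlN)
    have hlq : ¬ l ∣ q := prime_ne hq (by rintro rfl; exact hqD hlN)
    obtain ⟨j, -, hlj⟩ := (hl.out.prime.dvd_finsetProd_iff _).mp hlN
    obtain rfl : l = D j := (Nat.prime_dvd_prime_iff_eq hl.out (hD j).out).mp hlj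
    by_cases hji : j = i
    · subst hji
      have hlH : ¬ D j ∣ hatD D j := hl.out.not_dvd_prod_primes
        fun k hk h => (Finset.mem_erase.mp hk).1 (hinj h)
      -- At `l = D_i` the coefficient `d` vanishes modulo `l`; the point has `w = 0`, with `z²`
      -- equal to `q H` or `p H`.
      rcases hi with h | h
      · exact (TorsorSolvable.of_isSquare_zmod_left hl2 (ne_zero_mul hlq hlH) h).symm
      · exact TorsorSolvable.of_isSquare_zmod_left hl2 (ne_zero_mul hlp hlH) h
    · have hlH : ¬ D j ∣ ∏ k ∈ (Finset.univ.erase i).erase j, D k := hl.out.not_dvd_prod_primes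
        fun k hk h => (Finset.mem_erase.mp hk).1 (hinj h)
      rw [hatD_eq_mul_prod D hji, Nat.cast_mul]
      exact TorsorSolvable.of_multiplicative hl2 p q _
        (ne_zero (prime_ne (hD i).out fun h => hji (hinj h))) (ne_zero hlp) (ne_zero hlq)
        (ne_zero hlH) (hj j hji)
  · have hld : ¬ l ∣ D i := fun h => hlN (hN ▸ h.mul_right _)
    have hlH : ¬ l ∣ hatD D i := fun h => hlN (hN ▸ h.mul_left _)
    by_cases hlp : l = p
    · refine TorsorSolvable.of_left_eq_zero hl2 (ne_zero hld) ?_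
        (ne_zero_mul (prime_ne hq (hlp ▸ hpq_ne)) hlH)
      simp [← hlp]
    by_cases hlq : l = q
    · refine (TorsorSolvable.of_left_eq_zero hl2 (ne_zero hld) ?_
        (ne_zero_mul (prime_ne hp hlp) hlH)).symm
      simp [← hlq]
    refine TorsorSolvable.of_good_reduction hl2 (ne_zero hld) (ne_zero_mul (prime_ne hp hlp) hlH)
      (ne_zero_mul (prime_ne hq hlq) hlH) fun h => ?_
    -- The difference `q H - p H = 2 ^ m H` is a unit at `l`.
    have h1 : ((2 : ℤ) : ZMod l) ^ m * ((hatD D i : ℤ) : ZMod l) = 0 := by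
      rw [hpq] at h
      push_cast at h ⊢
      linear_combination -h
    exact mul_ne_zero (pow_ne_zero m hl_two) (ne_zero hlH) h1

/-- A nonzero natural number as a unit of `ℚ`. -/
def ratUnit (k : ℕ) (hk : k ≠ 0) : ℚˣ := Units.mk0 (k : ℚ) (by exact_mod_cast hk)

theorem mem_selmerDual {m p q n : ℕ} (hp : p.Prime) (hq : q.Prime)
    (hp2 : p ≠ 2) (hpq : q = p + 2 ^ m) (hm : 2 ≤ m)
    (D : Fin n → ℕ) [hD : ∀ i, Fact (D i).Prime] (hinj : Function.Injective D)
    (h2D : ¬ 2 ∣ totalD D) (hpD : ¬ p ∣ totalD D) (hqD : ¬ q ∣ totalD D)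
    {i : Fin n} (hi : i ∈ solvableIndices p q D m) :
    (ratUnit (D i) (hD i).out.ne_zero : RatSqClass) ∈
      selmerDual (-1) p q m (totalD D) (totalD_ne_zero D) := by
  obtain ⟨hI, hPi⟩ := Finset.mem_filter.mp hi
  replace hI : InIndexSet m p (totalD D) (D i) := by simpa [indexSet] using hI
  have hN : (totalD D : ℚ) = D i * hatD D i := by exact_mod_cast totalD_eq_mul_hatD D i
  have hpq' : (q : ℚ) = p + 2 ^ m := by exact_mod_cast hpq
  have ha : (-2 * ((-1 : ℤ) : ℚ) * (p + q) * totalD D : ℚ) =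
      2 * (((D i : ℤ) : ℚ) * ((p * hatD D i : ℤ) : ℚ) + ((D i : ℤ) : ℚ) * ((q * hatD D i : ℤ) : ℚ)) := by
    rw [hN]
    push_cast
    ring
  have hb : (4 ^ m * totalD D ^ 2 : ℚ) =
      (((D i : ℤ) : ℚ) * ((q * hatD D i : ℤ) : ℚ) - ((D i : ℤ) : ℚ) * ((p * hatD D i : ℤ) : ℚ)) ^ 2 := by
    have h4 : (4 : ℚ) ^ m = (2 ^ m) ^ 2 := by rw [← pow_mul, mul_comm, pow_mul]; norm_num
    rw [hN, h4]
    push_cast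
    rw [hpq']
    ring
  have hu : (ratUnit (D i) (hD i).out.ne_zero : ℚ) = ((D i : ℤ) : ℚ) := by simp [ratUnit]
  refine Subgroup.mem_map_of_mem _ (Subgroup.mem_inf.mpr ⟨?_, Subgroup.mem_iInf.mpr fun l => ?_⟩)
  · exact (TorsorSolvable.real (by exact_mod_cast (hD i).out.pos) _ _).mem_placeSubgroup
      _ _ _ ha hb _ hu
  · have : Fact (l : ℕ).Prime := ⟨l.2⟩
    exact (torsorSolvable_padic hp hq hp2 hpq hm D hinj h2D hpD hqD hI hPi l).mem_placeSubgroup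
      _ _ _ ha hb _ hu

/-! ### Independence of distinct primes modulo squares. -/

/-- The `l`-adic valuation modulo `2` on `ℚ*/ℚ*²`. -/
def valModTwo (l : ℕ) [Fact l.Prime] : RatSqClass →* Multiplicative (ZMod 2) :=
  QuotientGroup.lift _
    { toFun := fun u => Multiplicative.ofAdd ((padicValRat l (u : ℚ) : ℤ) : ZMod 2)
      map_one' := by simp
      map_mul' := fun u v => by
        rw [Units.val_mul, padicValRat.mul u.ne_zero v.ne_zero, Int.cast_add, ofAdd_add] }
    (by
      rintro _ ⟨u, rfl⟩
      have h2 : (2 : ZMod 2) = 0 := rfl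
      simp [padicValRat.pow, h2])

theorem valModTwo_ratUnit (l k : ℕ) [Fact l.Prime] [hk : Fact k.Prime] :
    (valModTwo l (ratUnit k hk.out.ne_zero : RatSqClass)).toAdd = if k = l then 1 else 0 := by
  have h : (valModTwo l (ratUnit k hk.out.ne_zero : RatSqClass)).toAdd
      = ((padicValRat l (k : ℚ) : ℤ) : ZMod 2) := rfl
  rw [h, padicValRat.of_nat]
  split_ifs with hkl
  · subst hkl
    simp
  · rw [padicValNat_primes (Ne.symm hkl)]
    simp

/-- The valuations modulo `2` at the `D j` send these classes to the standard basis. -/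
theorem linearIndependent_ratUnit {ι : Type} [Finite ι] (D : ι → ℕ) [hD : ∀ i, Fact (D i).Prime]
    (hinj : Function.Injective D) (S : Subgroup RatSqClass)
    (hS : ∀ i, (ratUnit (D i) (hD i).out.ne_zero : RatSqClass) ∈ S) :
    LinearIndependent (ZMod 2) (fun i => Additive.ofMul (⟨_, hS i⟩ : S)) := by
  classical
  have := Fintype.ofFinite ι
  let f : Additive S →+ (ι → ZMod 2) := AddMonoidHom.pi fun j =>
    MonoidHom.toAdditiveLeft ((valModTwo (D j)).comp S.subtype)
  refine LinearIndependent.of_comp (f.toZModLinearMap 2) ?_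
  have key : f.toZModLinearMap 2 ∘ (fun i => Additive.ofMul (⟨_, hS i⟩ : S)) =
      Pi.basisFun (ZMod 2) ι := by
    ext i j
    rw [Pi.basisFun_apply, Pi.single_apply]
    have h := valModTwo_ratUnit (D j) (D i)
    simp only [hinj.eq_iff, eq_comm (a := i)] at h
    exact h
  rw [key]
  exact (Pi.basisFun (ZMod 2) ι).linearIndependent

theorem nonempty_closure_mulEquiv {ι : Type} [Fintype ι] (D : ι → ℕ) [hD : ∀ i, Fact (D i).Prime]
    (hinj : Function.Injective D) :
    Nonempty (Subgroup.closure (Set.range fun i => (ratUnit (D i) (hD i).out.ne_zero : RatSqClass))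
      ≃* Multiplicative (Fin (Fintype.card ι) → ZMod 2)) := by
  set C := Subgroup.closure (Set.range fun i => (ratUnit (D i) (hD i).out.ne_zero : RatSqClass))
  have hC : ∀ i, (ratUnit (D i) (hD i).out.ne_zero : RatSqClass) ∈ C := fun i =>
    Subgroup.subset_closure ⟨i, rfl⟩
  have hli := linearIndependent_ratUnit D hinj C hC
  have hsp : ⊤ ≤ Submodule.span (ZMod 2)
      (Set.range fun i => Additive.ofMul (⟨_, hC i⟩ : C)) := by
    rintro x -
    obtain ⟨⟨x, hx⟩, rfl⟩ := Additive.ofMul.surjective x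
    induction hx using Subgroup.closure_induction with
    | mem x hx =>
      obtain ⟨i, rfl⟩ := hx
      exact Submodule.subset_span ⟨i, rfl⟩
    | one => exact Submodule.zero_mem _
    | mul x y hx hy ihx ihy => exact Submodule.add_mem _ ihx ihy
    | inv x hx ih => exact Submodule.neg_mem _ ih
  let e := ((Module.Basis.mk hli hsp).reindex (Fintype.equivFin ι)).equivFun
  exact ⟨AddEquiv.toMultiplicativeRight e.toAddEquiv⟩

end

theorem theoremA4 (m p q n : ℕ) (hm : 2 ≤ m) (hp : p.Prime) (hq : q.Prime)
    (hp2 : p ≠ 2) (hq2 : q ≠ 2) (hpq : q = p + 2 ^ m)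
    (D : Fin n → ℕ) [∀ i, Fact (D i).Prime] (hinj : Function.Injective D)
    (h2D : ¬ 2 ∣ totalD D) (hpD : ¬ p ∣ totalD D) (hqD : ¬ q ∣ totalD D) :
    (∃ T : Finset ℚˣ,
      (∀ t ∈ T, ∃ i, (t : ℚ) = D i) ∧
      T.card = rhoMinus m p q D ∧
      Subgroup.closure ((fun t : ℚˣ => (t : RatSqClass)) '' (T : Set ℚˣ)) ≤
        selmerDual (-1) p q m (totalD D) (totalD_ne_zero D) ∧
      Nonempty (Subgroup.closure ((fun t : ℚˣ => (t : RatSqClass)) '' (T : Set ℚˣ)) ≃*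
        Multiplicative (Fin (rhoMinus m p q D) → ZMod 2))) ∧
    (rhoMinus m p q D : Cardinal) ≤
      dimTwo (selmerDual (-1) p q m (totalD D) (totalD_ne_zero D)) := by
  classical
  have hD : ∀ i, (D i).Prime := fun i => Fact.out
  have hmem : ∀ i : solvableIndices p q D m, _ := fun i =>
    mem_selmerDual hp hq hp2 hpq hm D hinj h2D hpD hqD i.2
  let D' : solvableIndices p q D m → ℕ := fun i => D i
  have : ∀ i, Fact (D' i).Prime := fun i => ⟨hD i⟩
  have hD' : Function.Injective D' := hinj.comp Subtype.val_injective
  have hcard : Fintype.card (solvableIndices p q D m) = rhoMinus m p q D := by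
    rw [Fintype.card_coe, card_solvableIndices]
  let u : Fin n → ℚˣ := fun i => ratUnit (D i) (hD i).ne_zero
  have hu : Function.Injective u := fun i j h => by
    have h1 : (u i : ℚ) = u j := by rw [h]
    exact hinj (by simpa [u, ratUnit] using h1)
  have himage : (fun t : ℚˣ => (t : RatSqClass)) ''
      (((solvableIndices p q D m).image u : Finset ℚˣ) : Set ℚˣ) =
      Set.range fun i => (ratUnit (D' i) (hD i).ne_zero : RatSqClass) := by
    ext x
    simp only [u, D', Set.mem_image, Set.mem_range, Finset.coe_image, Finset.mem_coe,
      exists_exists_and_eq_and, Subtype.exists]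
    exact exists_congr fun _ => exists_prop.symm
  refine ⟨⟨(solvableIndices p q D m).image u, ?_, ?_, ?_, ?_⟩, ?_⟩
  · intro t ht
    obtain ⟨i, -, rfl⟩ := Finset.mem_image.mp ht
    exact ⟨i, by simp [u, ratUnit]⟩
  · rw [Finset.card_image_of_injective _ hu, card_solvableIndices]
  · rw [himage, Subgroup.closure_le]
    rintro _ ⟨i, rfl⟩
    exact hmem i
  · rw [himage, ← hcard]
    exact nonempty_closure_mulEquiv D' hD'
  · rw [← hcard, ← Cardinal.mk_fintype]
    exact (linearIndependent_ratUnit D' hD' _ hmem).cardinal_le_rank
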